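/- Let $n\ge 2$ be an integer, $\mu\in\mathbb R$, and let $V=\mathrm H_n(\mathbb C)$ be the real vector space of complex hermitian $n\times n$ matrices, with matrix product $u\cdot v$, commutator $[u,v]=u\cdot v-v\cdot u$, Jordan product $uv=\tfrac12(u\cdot v+v\cdot u)$, identity matrix $e$ and inner product $\langle u\mid v\rangle=\tfrac1n\mathrm{tr}(uv)$. Write $L_u(v)=uv$, $S_{uv}=[L_u,L_v]+L_{uv}$ and $\{uvw\}=S_{uv}(w)$. Let $\mathcal C_1\subset V$ be the cone of positive semidefinite matrices of rank one and $T\mathcal C_1=\{(x,\pi): x\in\mathcal C_1,\ \pi\in \mathrm{Im}\,L_x\}$ its tangent bundle. For $u,v\in V$ define real-valued functions on $T\mathcal C_1$ by $$\mathcal X_u=\langle x\mid\{\pi u\pi\}\rangle+\frac{n\mu^2}{(\mathrm{tr}\,x)^2}\mathrm{tr}(xu)-\mu\,\mathrm i\,\frac{\mathrm{tr}(x[u,\pi])}{\mathrm{tr}\,x},\qquad \mathcal Y_v=\langle v\mid x\rangle,\qquad \mathcal S_{uv}=\langle S_{uv}(x)\mid\pi\rangle-\mu\,\mathrm i\,\frac{\mathrm{tr}(x[u,v])}{2\,\mathrm{tr}\,x},$$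 and $\mathcal L_u=\mathcal S_{ue}$, $\mathcal L_{u,v}=\tfrac12(\mathcal S_{uv}-\mathcal S_{vu})$. (These are the functions of the $\mathfrak{su}(n,n)$ Poisson realization.) Let $(e_\alpha)$ be an orthonormal basis of $V$. Then, for every $u\in V$, the following identities of functions on $T\mathcal C_1$ hold (the first is called the primary quadratic relation, the others the secondary ones): 1. $\frac2n\sum_\alpha\mathcal L_{e_\alpha}^2-\mathcal L_e^2-\mathcal X_e\mathcal Y_e=-\mu^2$; 2. $\sum_\alpha\mathcal X_{e_\alpha}\mathcal L_{e_\alpha}=n\,\mathcal X_e\mathcal L_e$ and $\sum_\alpha\mathcal Y_{e_\alpha}\mathcal L_{e_\alpha}=n\,\mathcal Y_e\mathcal L_e$; 3. $\frac4n\sum_\alpha\mathcal L_{e_\alpha,u}\mathcal L_{e_\alpha}=-\mathcal X_u\mathcal Y_e+\mathcal X_e\mathcal Y_u$; 4. $\sum_\alpha\mathcal X_{e_\alpha}^2=n\,\mathcal X_e^2$ and $\sum_\alpha\mathcal Y_{e_\alpha}^2=n\,\mathcal Y_e^2$; 5. $\frac2n\sum_\alpha\mathcal L_{e_\alpha,u}\mathcal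 X_{e_\alpha}=-\mathcal X_u\mathcal L_e+\mathcal L_u\mathcal X_e$ and $\frac2n\sum_\alpha\mathcal L_{e_\alpha,u}\mathcal Y_{e_\alpha}=\mathcal Y_u\mathcal L_e-\mathcal L_u\mathcal Y_e$; 6. $\sum_\alpha\mathcal X_{e_\alpha}\mathcal Y_{e_\alpha}=n(\mathcal L_e^2+\mu^2)$; 7. $\frac4{n^3}\sum_{\alpha,\beta}\mathcal L_{e_\alpha,e_\beta}^2=\mathcal X_e\mathcal Y_e-\mathcal L_e^2+\frac{n-2}{n}\mu^2$. -/

import Mathlib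

namespace U1Kepler

/-- `H_n(ℂ)`: the real vector space of complex hermitian matrices of order `n`. -/
abbrev Herm (n : ℕ) : Type := selfAdjoint (Matrix (Fin n) (Fin n) ℂ)

variable {n : ℕ}

/-- The Jordan product `u v = (u·v + v·u)/2` on `H_n(ℂ)`, where `·` is the matrix product. -/
noncomputable def jordanMul (u v : Herm n) : Herm n :=
  ⟨(1 / 2 : ℝ) • ((u : Matrix (Fin n) (Fin n) ℂ) * (v : Matrix (Fin n) (Fin n) ℂ)
        + (v : Matrix (Fin n) (Fin n) ℂ) * (u : Matrix (Fin n) (Fin n) ℂ)), by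
      have hu : star (u : Matrix (Fin n) (Fin n) ℂ) = u := u.2
      have hv : star (v : Matrix (Fin n) (Fin n) ℂ) = v := v.2
      rw [selfAdjoint.mem_iff, star_smul, star_add, star_mul, star_mul, hu, hv, add_comm,
        star_trivial]⟩

/-- The Jordan multiplication operator `L_u : v ↦ u v` on `H_n(ℂ)`. -/
noncomputable def jordanL (u : Herm n) : Module.End ℝ (Herm n) where
  toFun v := jordanMul u v
  map_add' v w := by
    apply Subtype.ext
    change (1 / 2 : ℝ) • ((u : Matrix (Fin n) (Fin n) ℂ) * (v + w : Matrix (Fin n) (Fin n) ℂ)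
      + (v + w : Matrix (Fin n) (Fin n) ℂ) * (u : Matrix (Fin n) (Fin n) ℂ)) =
      (1 / 2 : ℝ) • ((u : Matrix (Fin n) (Fin n) ℂ) * (v : Matrix (Fin n) (Fin n) ℂ)
        + (v : Matrix (Fin n) (Fin n) ℂ) * (u : Matrix (Fin n) (Fin n) ℂ)) +
      (1 / 2 : ℝ) • ((u : Matrix (Fin n) (Fin n) ℂ) * (w : Matrix (Fin n) (Fin n) ℂ)
        + (w : Matrix (Fin n) (Fin n) ℂ) * (u : Matrix (Fin n) (Fin n) ℂ))
    rw [← smul_add, mul_add, add_mul]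
    congr 1
    abel
  map_smul' r v := by
    apply Subtype.ext
    change (1 / 2 : ℝ) • ((u : Matrix (Fin n) (Fin n) ℂ) * (r • (v : Matrix (Fin n) (Fin n) ℂ))
      + (r • (v : Matrix (Fin n) (Fin n) ℂ)) * (u : Matrix (Fin n) (Fin n) ℂ)) =
      r • ((1 / 2 : ℝ) • ((u : Matrix (Fin n) (Fin n) ℂ) * (v : Matrix (Fin n) (Fin n) ℂ)
        + (v : Matrix (Fin n) (Fin n) ℂ) * (u : Matrix (Fin n) (Fin n) ℂ)))
    rw [mul_smul_comm, smul_mul_assoc, ← smul_add, smul_comm]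

/-- `S_{uv} = [L_u, L_v] + L_{uv}`, an endomorphism of `H_n(ℂ)`. -/
noncomputable def jordanS (u v : Herm n) : Module.End ℝ (Herm n) :=
  ⁅jordanL u, jordanL v⁆ + jordanL (jordanMul u v)

/-- The Jordan triple product `{u v w} = S_{uv}(w)`. -/
noncomputable def triple (u v w : Herm n) : Herm n := jordanS u v w

/-- The matrix trace of a hermitian matrix, as a real number. -/
noncomputable def tr (u : Herm n) : ℝ :=
  (Matrix.trace (u : Matrix (Fin n) (Fin n) ℂ)).re

/-- The inner product `⟨u | v⟩ = (1/n) tr (u v)` (`u v` the Jordan product), for which the identity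
matrix is a unit vector. -/
noncomputable def ip (u v : Herm n) : ℝ := (1 / (n : ℝ)) * tr (jordanMul u v)

/-- The real number `i tr (x [u, v])`, where `[u, v] = u·v - v·u` is the matrix commutator. -/
noncomputable def iTrComm (x u v : Herm n) : ℝ :=
  (Complex.I * Matrix.trace ((x : Matrix (Fin n) (Fin n) ℂ) *
    ((u : Matrix (Fin n) (Fin n) ℂ) * (v : Matrix (Fin n) (Fin n) ℂ)
      - (v : Matrix (Fin n) (Fin n) ℂ) * (u : Matrix (Fin n) (Fin n) ℂ)))).re

/-- Nothing is lost by taking the real part in `tr`. -/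
theorem ofReal_tr (u : Herm n) :
    ((tr u : ℝ) : ℂ) = Matrix.trace (u : Matrix (Fin n) (Fin n) ℂ) := by
  have hu : star (u : Matrix (Fin n) (Fin n) ℂ) = u := u.2
  have h : star (Matrix.trace (u : Matrix (Fin n) (Fin n) ℂ))
      = Matrix.trace (u : Matrix (Fin n) (Fin n) ℂ) := by
    rw [← Matrix.trace_conjTranspose, ← Matrix.star_eq_conjTranspose, hu]
  exact Complex.conj_eq_iff_re.mp h

/-- Nothing is lost by taking the real part in `iTrComm`. -/
theorem ofReal_iTrComm (x u v : Herm n) :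
    ((iTrComm x u v : ℝ) : ℂ) =
      Complex.I * Matrix.trace ((x : Matrix (Fin n) (Fin n) ℂ) *
        ((u : Matrix (Fin n) (Fin n) ℂ) * (v : Matrix (Fin n) (Fin n) ℂ)
          - (v : Matrix (Fin n) (Fin n) ℂ) * (u : Matrix (Fin n) (Fin n) ℂ))) := by
  have hx : star (x : Matrix (Fin n) (Fin n) ℂ) = x := x.2
  have hu : star (u : Matrix (Fin n) (Fin n) ℂ) = u := u.2
  have hv : star (v : Matrix (Fin n) (Fin n) ℂ) = v := v.2
  refine Complex.conj_eq_iff_re.mp ?_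
  rw [map_mul, Complex.conj_I]
  change -Complex.I * star (Matrix.trace _) = _
  rw [← Matrix.trace_conjTranspose, ← Matrix.star_eq_conjTranspose, star_mul, star_sub, star_mul,
    star_mul, hx, hu, hv, Matrix.trace_mul_comm, neg_mul, ← mul_neg, ← Matrix.trace_neg,
    ← mul_neg, neg_sub]

open scoped ComplexOrder in
/-- The total space of the tangent bundle `T𝒞₁` of the Kepler cone `𝒞₁` of rank-one positive
semidefinite hermitian matrices, as a subset of `H_n(ℂ) × H_n(ℂ)`: a point is a pair `(x, π)` with
`x ∈ 𝒞₁` and `π` in the tangent space `T_x 𝒞₁ = Im L_x`. -/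
structure TangentCone (n : ℕ) where
  /-- the base point -/
  x : Herm n
  /-- the tangent vector -/
  p : Herm n
  posSemidef : (x : Matrix (Fin n) (Fin n) ℂ).PosSemidef
  rank_eq_one : (x : Matrix (Fin n) (Fin n) ℂ).rank = 1
  tangent : p ∈ LinearMap.range (jordanL x)

/-- `𝒳_u = ⟨x | {π u π}⟩ + n μ² tr (x u) / (tr x)² - μ i tr (x [u, π]) / tr x`. -/
noncomputable def fX (μ : ℝ) (u : Herm n) (Q : TangentCone n) : ℝ :=
  ip Q.x (triple Q.p u Q.p) + (n * μ ^ 2 / tr Q.x ^ 2) * tr (jordanMul Q.x u)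
    - μ * (iTrComm Q.x u Q.p / tr Q.x)

/-- `𝒴_v = ⟨v | x⟩`. -/
noncomputable def fY (v : Herm n) (Q : TangentCone n) : ℝ := ip v Q.x

/-- `𝒮_{uv} = ⟨S_{uv}(x) | π⟩ - μ i tr (x [u, v]) / (2 tr x)`. -/
noncomputable def fS (μ : ℝ) (u v : Herm n) (Q : TangentCone n) : ℝ :=
  ip (jordanS u v Q.x) Q.p - μ * (iTrComm Q.x u v / (2 * tr Q.x))

/-- `ℒ_u = 𝒮_{ue}`, with `e` the identity matrix. -/
noncomputable def fL (μ : ℝ) (u : Herm n) (Q : TangentCone n) : ℝ := fS μ u 1 Q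

/-- `ℒ_{u,v} = (𝒮_{uv} - 𝒮_{vu}) / 2`. -/
noncomputable def fLL (μ : ℝ) (u v : Herm n) (Q : TangentCone n) : ℝ :=
  (1 / 2) * (fS μ u v Q - fS μ v u Q)

end U1Kepler

namespace U1Kepler

open Matrix
open scoped ComplexOrder

/-! Write x = z z^* and put w = π z + i (n μ / |z|²) z (`momentumVec`). The shift of π z by an
imaginary multiple of z absorbs every μ-term, leaving n 𝒴_v = tr(v z z^*), n 𝒳_u = tr(u w w^*) and
2n 𝒮_{uv} = tr(u v z w^*) + tr(v u w z^*) (`ofReal_fY`, `ofReal_fX`, `ofReal_fS`). Completeness of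
the basis, Σ tr(e_α A) tr(e_α B) = n tr(A B) (`sum_trace_mul_trace`), turns each sum into a trace of
products of rank-one matrices, hence a polynomial in inner products of z, w, u z, u w. From then on
μ enters only through z^* w - w^* z = 2 i n μ (`star_dotProduct_momentumVec`), and each relation is
a polynomial identity. -/

/-- The rank-one matrix `a · b^*`. -/
noncomputable def ketBra {n : ℕ} (a b : Fin n → ℂ) : Matrix (Fin n) (Fin n) ℂ :=
  vecMulVec a (star b)

/-! ### Calculus of rank-one matrices. -/

section RankOne

variable {n : ℕ} (a b c d : Fin n → ℂ) (A B : Matrix (Fin n) (Fin n) ℂ)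

theorem ketBra_mul_ketBra : ketBra a b * ketBra c d = (star b ⬝ᵥ c) • ketBra a d := by
  ext i j
  simp only [ketBra, mul_apply, vecMulVec_apply, Matrix.smul_apply, dotProduct, smul_eq_mul,
    Finset.sum_mul]
  exact Finset.sum_congr rfl fun k _ => by ring

theorem trace_ketBra : (ketBra a b).trace = star b ⬝ᵥ a := by
  simp only [ketBra, trace, diag_apply, vecMulVec_apply, dotProduct]
  exact Finset.sum_congr rfl fun k _ => by ring

theorem mul_ketBra : A * ketBra a b = ketBra (A *ᵥ a) b := by
  ext i j
  simp only [ketBra, mul_apply, vecMulVec_apply, mulVec, dotProduct, Finset.sum_mul]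
  exact Finset.sum_congr rfl fun k _ => by ring

theorem ketBra_mul_of_star_eq (hA : star A = A) : ketBra a b * A = ketBra a (A *ᵥ b) := by
  have h : ∀ i j, star (A i j) = A j i := fun i j => congrFun (congrFun hA j) i
  ext i j
  simp only [ketBra, mul_apply, vecMulVec_apply, mulVec, dotProduct, Pi.star_apply, star_sum,
    star_mul, Finset.mul_sum]
  exact Finset.sum_congr rfl fun k _ => by rw [h]; ring

theorem ketBra_add_left : ketBra (a + b) c = ketBra a c + ketBra b c := add_vecMulVec _ _ _

theorem ketBra_add_right : ketBra a (b + c) = ketBra a b + ketBra a c := by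
  simp [ketBra, vecMulVec_add]

theorem ketBra_smul_left (k : ℂ) : ketBra (k • a) b = k • ketBra a b := smul_vecMulVec _ _ _

theorem ketBra_smul_right (k : ℂ) : ketBra a (k • b) = star k • ketBra a b := by
  simp [ketBra, vecMulVec_smul]

/-- A positive semidefinite matrix of rank one is `z · z^*` for some vector `z`. -/
theorem exists_eq_ketBra_self {n : ℕ} {x : Matrix (Fin n) (Fin n) ℂ}
    (hx : x.PosSemidef) (hr : x.rank = 1) :
    ∃ z : Fin n → ℂ, x = ketBra z z ∧ star z ⬝ᵥ z ≠ 0 := by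
  have hstar : ∀ i j, star (x i j) = x j i := fun i j => hx.isHermitian.apply j i
  obtain ⟨⟨v, _⟩, hv, hspan⟩ :=
    (finrank_eq_one_iff' (K := ℂ) (V := LinearMap.range x.mulVecLin)).mp hr
  have hcol : ∀ j, ∃ c : ℂ, ∀ i, x i j = v i * c := fun j => by
    obtain ⟨c, hc⟩ := hspan ⟨x.mulVecLin (Pi.single j 1), LinearMap.mem_range_self _ _⟩
    refine ⟨c, fun i => ?_⟩
    have := congrFun (congrArg Subtype.val hc) i
    simp only [SetLike.mk_smul_mk, Pi.smul_apply, smul_eq_mul, mulVecLin_apply,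
      mulVec_single_one] at this
    rw [mul_comm, this]; rfl
  choose c hc using hcol
  have hv' : v ≠ 0 := fun h => hv (Subtype.ext h)
  obtain ⟨k, hk⟩ := Function.ne_iff.mp hv'
  have hx0 : x ≠ 0 := by
    rintro rfl
    simp at hr
  have hkk : x k k ≠ 0 := by
    intro h0
    apply hx0
    have hck : c k = 0 := by
      rw [hc k k] at h0
      exact (mul_eq_zero.mp h0).resolve_left hk
    have hcz : ∀ j, c j = 0 := fun j => by
      have h1 : x k j = 0 := by rw [← hstar, hc, hck]; simp
      rw [hc j k] at h1
      exact (mul_eq_zero.mp h1).resolve_left hk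
    ext i j
    rw [hc, hcz]; simp
  have hnn := hx.diag_nonneg (i := k)
  obtain ⟨hre, him⟩ := Complex.le_def.mp hnn
  set t : ℝ := (x k k).re with ht
  have hxt : x k k = (t : ℂ) := Complex.ext (by simp [ht]) (by simpa using him.symm)
  have ht0 : 0 < t := lt_of_le_of_ne hre fun h => hkk (by rw [hxt, ← h]; simp)
  have hsq : ((Real.sqrt t : ℝ) : ℂ) * (Real.sqrt t : ℝ) = t := by
    rw [← Complex.ofReal_mul, Real.mul_self_sqrt ht0.le]
  have hs0 : ((Real.sqrt t : ℝ) : ℂ) ≠ 0 := by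
    simpa using (Real.sqrt_pos.mpr ht0).ne'
  have ht0' : (t : ℂ) ≠ 0 := by simpa using ht0.ne'
  -- The vector z is a column of x through a nonzero diagonal entry t, scaled by 1/√t; the claim
  -- reduces to the vanishing minor x i j * x k k = x i k * x k j.
  have heq : x = ketBra (fun i => x i k / (Real.sqrt t : ℝ))
      (fun i => x i k / (Real.sqrt t : ℝ)) := by
    ext i j
    have h1 : star (x j k / (Real.sqrt t : ℝ)) = x k j / (Real.sqrt t : ℝ) := by
      rw [star_div₀, hstar]
      congr 1
      exact Complex.conj_ofReal _
    simp only [ketBra, vecMulVec_apply, Pi.star_apply, h1]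
    rw [div_mul_div_comm, hsq, eq_div_iff ht0', ← hxt, hc j i, hc k k, hc k i, hc j k]
    ring
  refine ⟨_, heq, fun h => hx0 ?_⟩
  rw [heq, dotProduct_star_self_eq_zero.mp h]
  ext; simp [ketBra, vecMulVec_apply]

end RankOne

/-! ### Completeness relations of an orthonormal basis. -/

section Completeness

variable {n : ℕ}

@[simp]
theorem coe_jordanMul (u v : Herm n) :
    (jordanMul u v : Matrix (Fin n) (Fin n) ℂ) = (1 / 2 : ℂ) •
      ((u : Matrix (Fin n) (Fin n) ℂ) * (v : Matrix (Fin n) (Fin n) ℂ)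
        + (v : Matrix (Fin n) (Fin n) ℂ) * (u : Matrix (Fin n) (Fin n) ℂ)) := by
  ext i j
  simp [jordanMul, mul_add]

theorem trace_eq_ofReal_ip (hn : n ≠ 0) (u v : Herm n) :
    ((u : Matrix (Fin n) (Fin n) ℂ) * v).trace = n * (ip u v : ℝ) := by
  have : (n : ℂ) ≠ 0 := by exact_mod_cast hn
  rw [ip, Complex.ofReal_mul, ofReal_tr, coe_jordanMul, trace_smul, trace_add,
    trace_mul_comm (v : Matrix (Fin n) (Fin n) ℂ) (u : Matrix (Fin n) (Fin n) ℂ)]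
  push_cast
  simp only [smul_eq_mul]
  field_simp
  norm_num

theorem ofReal_ip (hn : n ≠ 0) (u v : Herm n) :
    ((ip u v : ℝ) : ℂ) = (1 / n) * ((u : Matrix (Fin n) (Fin n) ℂ) * v).trace := by
  have : (n : ℂ) ≠ 0 := by exact_mod_cast hn
  rw [trace_eq_ofReal_ip hn]; field_simp

variable {ι : Type*} [Fintype ι] {e : Module.Basis ι ℝ (Herm n)}
  (hunit : ∀ α, ip (e α) (e α) = 1) (horth : ∀ α β, α ≠ β → ip (e α) (e β) = 0)

include hunit horth in
theorem sum_ip_smul (hn : n ≠ 0) (v : Herm n) :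
    ∑ α, (((e α : Matrix (Fin n) (Fin n) ℂ) * v).trace) • (e α : Matrix (Fin n) (Fin n) ℂ)
      = (n : ℂ) • (v : Matrix (Fin n) (Fin n) ℂ) := by
  classical
  have hv : (v : Matrix (Fin n) (Fin n) ℂ)
      = ∑ β, ((e.repr v β : ℝ) : ℂ) • (e β : Matrix (Fin n) (Fin n) ℂ) := by
    conv_lhs => rw [← e.sum_repr v]
    rw [AddSubgroup.val_finsetSum]
    refine Finset.sum_congr rfl fun β _ => ?_
    ext i j
    simp
  have hcoef : ∀ α, ((e α : Matrix (Fin n) (Fin n) ℂ) * v).trace = n * (e.repr v α : ℝ) := by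
    intro α
    rw [hv, Finset.mul_sum, trace_sum, Finset.sum_eq_single α]
    · rw [mul_smul_comm, trace_smul, trace_eq_ofReal_ip hn, hunit]
      simp [mul_comm]
    · intro β _ hβ
      rw [mul_smul_comm, trace_smul, trace_eq_ofReal_ip hn, horth α β hβ.symm]
      simp
    · simp
  simp_rw [hcoef, mul_smul, ← Finset.smul_sum]
  rw [← hv]

include hunit horth in
/-- The completeness relation of an orthonormal basis of `H_n(ℂ)`, for arbitrary matrices. -/
theorem sum_trace_smul (hn : n ≠ 0) (A : Matrix (Fin n) (Fin n) ℂ) :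
    ∑ α, (((e α : Matrix (Fin n) (Fin n) ℂ) * A).trace) • (e α : Matrix (Fin n) (Fin n) ℂ)
      = (n : ℂ) • A := by
  -- Both sides are complex linear in A, and hermitian matrices span all matrices over ℂ. The
  -- extension is needed because z w^* is not hermitian.
  have h1 := sum_ip_smul hunit horth hn (realPart A)
  have h2 := sum_ip_smul hunit horth hn (imaginaryPart A)
  have hA := realPart_add_I_smul_imaginaryPart A
  conv_lhs => rw [← hA]
  conv_rhs => rw [← hA]
  rw [smul_add, smul_comm, ← h1, ← h2, Finset.smul_sum, ← Finset.sum_add_distrib]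
  refine Finset.sum_congr rfl fun α _ => ?_
  rw [mul_add, trace_add, mul_smul_comm, trace_smul, add_smul, smul_assoc]

include hunit horth in
theorem sum_trace_mul_trace (hn : n ≠ 0) (A B : Matrix (Fin n) (Fin n) ℂ) :
    ∑ α, ((e α : Matrix (Fin n) (Fin n) ℂ) * A).trace * ((e α : Matrix (Fin n) (Fin n) ℂ) * B).trace
      = n * (A * B).trace := by
  have h := congrArg (fun M => (M * B).trace) (sum_trace_smul hunit horth hn A)
  simpa only [Finset.sum_mul, trace_sum, smul_mul_assoc, trace_smul, smul_eq_mul] using h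

-- Testing completeness on matrix units gives Σ (e_α)_{ij} (e_α)_{kl} = n δ_{il} δ_{jk}; contracting
-- with A leaves its trace.
include hunit horth in
theorem sum_mul_mul (hn : n ≠ 0) (A : Matrix (Fin n) (Fin n) ℂ) :
    ∑ α, (e α : Matrix (Fin n) (Fin n) ℂ) * A * e α = ((n : ℂ) * A.trace) • 1 := by
  classical
  have hentry : ∀ i j k l, ∑ α, (e α : Matrix (Fin n) (Fin n) ℂ) i j * (e α : Matrix _ _ ℂ) k l
      = n * (if i = l ∧ j = k then 1 else 0) := by
    intro i j k l
    have h := congrFun (congrFun (sum_trace_smul hunit horth hn (single j i (1 : ℂ))) k) l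
    simp only [trace_mul_single, Matrix.sum_apply, Matrix.smul_apply, smul_eq_mul, single_apply] at h
    convert h using 2
    · simp
    · congr 1; simp only [and_comm]
  ext i l
  simp only [Matrix.sum_apply, mul_apply, Finset.sum_mul]
  rw [Finset.sum_comm]
  simp_rw [Finset.sum_comm (s := (Finset.univ : Finset ι))]
  have : ∀ k j, ∑ α, (e α : Matrix (Fin n) (Fin n) ℂ) i j * A j k * (e α : Matrix _ _ ℂ) k l
      = A j k * (n * (if i = l ∧ j = k then 1 else 0)) := fun k j => by
    rw [← hentry, Finset.mul_sum]
    exact Finset.sum_congr rfl fun α _ => by ring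
  simp_rw [this]
  by_cases hil : i = l
  · subst hil
    simp [trace, Finset.mul_sum, mul_comm]
  · simp [hil]

end Completeness

/-! ### The Poisson realization in terms of z and w. -/

section Vectors

variable {n : ℕ}

theorem coe_jordanS (u v w : Herm n) :
    (jordanS u v w : Matrix (Fin n) (Fin n) ℂ) = (1 / 2 : ℂ) •
      ((u : Matrix (Fin n) (Fin n) ℂ) * (v : Matrix (Fin n) (Fin n) ℂ)
          * (w : Matrix (Fin n) (Fin n) ℂ)
        + (w : Matrix (Fin n) (Fin n) ℂ) * (v : Matrix (Fin n) (Fin n) ℂ)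
          * (u : Matrix (Fin n) (Fin n) ℂ)) := by
  have h : jordanS u v w = jordanMul u (jordanMul v w) - jordanMul v (jordanMul u w)
      + jordanMul (jordanMul u v) w := rfl
  rw [h, AddSubgroup.coe_add, AddSubgroup.coe_sub]
  simp only [coe_jordanMul, mul_add, add_mul, smul_mul_assoc, mul_smul_comm, Matrix.mul_assoc]
  module

/-- The vector `π z + i (n μ / |z|²) z`. Together with `z` it determines all the functions of the
Poisson realization at the point `(z · z^*, π)`. -/
noncomputable def momentumVec (μ : ℝ) (p : Herm n) (z : Fin n → ℂ) : Fin n → ℂ :=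
  (p : Matrix (Fin n) (Fin n) ℂ) *ᵥ z + (Complex.I * (n * μ / (star z ⬝ᵥ z))) • z

variable {μ : ℝ} {Q : TangentCone n} {z : Fin n → ℂ}

theorem star_dotProduct_self (z : Fin n → ℂ) : star (star z ⬝ᵥ z) = star z ⬝ᵥ z :=
  (star_dotProduct z z).symm

theorem ketBra_momentumVec_left (c : Fin n → ℂ) (p : Herm n) :
    ketBra (momentumVec μ p z) c = ketBra ((p : Matrix (Fin n) (Fin n) ℂ) *ᵥ z) c
      + (Complex.I * (n * μ / (star z ⬝ᵥ z))) • ketBra z c := by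
  rw [momentumVec, ketBra_add_left, ketBra_smul_left]

theorem ketBra_momentumVec_right (c : Fin n → ℂ) (p : Herm n) :
    ketBra c (momentumVec μ p z) = ketBra c ((p : Matrix (Fin n) (Fin n) ℂ) *ᵥ z)
      - (Complex.I * (n * μ / (star z ⬝ᵥ z))) • ketBra c z := by
  have h : star (Complex.I * (n * μ / (star z ⬝ᵥ z))) = -(Complex.I * (n * μ / (star z ⬝ᵥ z))) := by
    rw [star_mul, star_div₀, star_mul, star_dotProduct_self]
    have hI : star Complex.I = -Complex.I := Complex.conj_I
    have hm : star (μ : ℂ) = μ := Complex.conj_ofReal _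
    rw [hI, hm, star_natCast]
    ring
  rw [momentumVec, ketBra_add_right, ketBra_smul_right, h, neg_smul, sub_eq_add_neg]

theorem star_dotProduct_mulVec (p : Herm n) (a c : Fin n → ℂ) :
    star ((p : Matrix (Fin n) (Fin n) ℂ) *ᵥ a) ⬝ᵥ c
      = star a ⬝ᵥ ((p : Matrix (Fin n) (Fin n) ℂ) *ᵥ c) := by
  rw [← trace_ketBra, ← trace_ketBra, ← ketBra_mul_of_star_eq _ _ _ p.2, ← mul_ketBra,
    trace_mul_comm]

/-- Since π is hermitian, z^* π z is real and cancels; only the imaginary shift survives. -/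
theorem star_dotProduct_momentumVec (hz : star z ⬝ᵥ z ≠ 0) (p : Herm n) :
    star z ⬝ᵥ momentumVec μ p z - star (momentumVec μ p z) ⬝ᵥ z = 2 * Complex.I * n * μ := by
  rw [← trace_ketBra, ← trace_ketBra, ketBra_momentumVec_left, ketBra_momentumVec_right, trace_add,
    trace_sub, trace_smul, trace_ketBra, trace_ketBra, trace_ketBra, star_dotProduct_mulVec]
  simp only [smul_eq_mul]
  field_simp
  ring

theorem ofReal_fY (hn : n ≠ 0) (hQ : (Q.x : Matrix (Fin n) (Fin n) ℂ) = ketBra z z) (v : Herm n) :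
    ((fY v Q : ℝ) : ℂ) = (1 / n) * ((v : Matrix (Fin n) (Fin n) ℂ) * ketBra z z).trace := by
  rw [fY, ofReal_ip hn, hQ]

/-- Expanding w w^*, the π z part gives the triple product, the cross terms give the commutator, and
the squared shift gives the μ² term, with tr x = |z|². -/
theorem ofReal_fX (hn : n ≠ 0) (hQ : (Q.x : Matrix (Fin n) (Fin n) ℂ) = ketBra z z)
    (hz : star z ⬝ᵥ z ≠ 0) (u : Herm n) :
    ((fX μ u Q : ℝ) : ℂ) = (1 / n) * ((u : Matrix (Fin n) (Fin n) ℂ) *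
      ketBra (momentumVec μ Q.p z) (momentumVec μ Q.p z)).trace := by
  have hn' : (n : ℂ) ≠ 0 := by exact_mod_cast hn
  have h1 : (ketBra z z * ((Q.p : Matrix (Fin n) (Fin n) ℂ) * (u : Matrix (Fin n) (Fin n) ℂ)
      * (Q.p : Matrix (Fin n) (Fin n) ℂ))).trace = ((u : Matrix (Fin n) (Fin n) ℂ) *
      ketBra ((Q.p : Matrix (Fin n) (Fin n) ℂ) *ᵥ z)
        ((Q.p : Matrix (Fin n) (Fin n) ℂ) *ᵥ z)).trace := by
    rw [← ketBra_mul_of_star_eq _ _ _ Q.p.2, ← mul_ketBra, trace_mul_comm]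
    simp only [Matrix.mul_assoc]
    rw [trace_mul_comm]
    simp only [Matrix.mul_assoc]
  have h2 : (ketBra z z * ((u : Matrix (Fin n) (Fin n) ℂ)
      * (Q.p : Matrix (Fin n) (Fin n) ℂ))).trace = ((u : Matrix (Fin n) (Fin n) ℂ) *
      ketBra ((Q.p : Matrix (Fin n) (Fin n) ℂ) *ᵥ z) z).trace := by
    rw [← mul_ketBra, trace_mul_comm, Matrix.mul_assoc]
  have h3 : (ketBra z z * ((Q.p : Matrix (Fin n) (Fin n) ℂ)
      * (u : Matrix (Fin n) (Fin n) ℂ))).trace = ((u : Matrix (Fin n) (Fin n) ℂ) *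
      ketBra z ((Q.p : Matrix (Fin n) (Fin n) ℂ) *ᵥ z)).trace := by
    rw [← ketBra_mul_of_star_eq _ _ _ Q.p.2, ← Matrix.mul_assoc, trace_mul_comm]
  rw [fX]
  push_cast
  rw [ofReal_ip hn, triple, coe_jordanS, ofReal_tr, ofReal_tr, ofReal_iTrComm, coe_jordanMul, hQ,
    trace_ketBra, ketBra_momentumVec_left, ketBra_momentumVec_right, ketBra_momentumVec_right]
  simp only [mul_add, mul_sub, smul_add, smul_sub, trace_add, trace_sub, trace_smul, mul_smul_comm,
    smul_eq_mul, h1, h2, h3, trace_mul_comm (ketBra z z) (u : Matrix (Fin n) (Fin n) ℂ)]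
  field_simp
  ring_nf
  simp only [Complex.I_sq]
  ring

theorem ofReal_fS (hn : n ≠ 0) (hQ : (Q.x : Matrix (Fin n) (Fin n) ℂ) = ketBra z z)
    (hz : star z ⬝ᵥ z ≠ 0) (u v : Herm n) :
    ((fS μ u v Q : ℝ) : ℂ) = (1 / (2 * n)) *
      (((u : Matrix (Fin n) (Fin n) ℂ) * (v : Matrix (Fin n) (Fin n) ℂ)
          * ketBra z (momentumVec μ Q.p z)).trace
        + ((v : Matrix (Fin n) (Fin n) ℂ) * (u : Matrix (Fin n) (Fin n) ℂ)
          * ketBra (momentumVec μ Q.p z) z).trace) := by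
  have hn' : (n : ℂ) ≠ 0 := by exact_mod_cast hn
  have h1 : ((u : Matrix (Fin n) (Fin n) ℂ) * (v : Matrix (Fin n) (Fin n) ℂ) * ketBra z z
      * (Q.p : Matrix (Fin n) (Fin n) ℂ)).trace = ((u : Matrix (Fin n) (Fin n) ℂ)
      * (v : Matrix (Fin n) (Fin n) ℂ) *
      ketBra z ((Q.p : Matrix (Fin n) (Fin n) ℂ) *ᵥ z)).trace := by
    rw [← ketBra_mul_of_star_eq _ _ _ Q.p.2, ← Matrix.mul_assoc]
  have h2 : (ketBra z z * (v : Matrix (Fin n) (Fin n) ℂ) * (u : Matrix (Fin n) (Fin n) ℂ)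
      * (Q.p : Matrix (Fin n) (Fin n) ℂ)).trace = ((v : Matrix (Fin n) (Fin n) ℂ)
      * (u : Matrix (Fin n) (Fin n) ℂ) *
      ketBra ((Q.p : Matrix (Fin n) (Fin n) ℂ) *ᵥ z) z).trace := by
    rw [← mul_ketBra, ← Matrix.mul_assoc, trace_mul_comm _ (ketBra z z)]
    simp only [Matrix.mul_assoc]
  have h3 : ∀ A : Matrix (Fin n) (Fin n) ℂ, (ketBra z z * A).trace = (A * ketBra z z).trace :=
    fun A => trace_mul_comm _ _
  rw [fS]
  push_cast
  rw [ofReal_ip hn, coe_jordanS, ofReal_tr, ofReal_iTrComm, hQ,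
    trace_ketBra, ketBra_momentumVec_left, ketBra_momentumVec_right]
  simp only [mul_add, mul_sub, add_mul, smul_add, trace_add, trace_sub, trace_smul,
    mul_smul_comm, smul_mul_assoc, smul_eq_mul, h1, h2]
  simp only [h3]
  field_simp
  ring

theorem ofReal_fL (hn : n ≠ 0) (hQ : (Q.x : Matrix (Fin n) (Fin n) ℂ) = ketBra z z)
    (hz : star z ⬝ᵥ z ≠ 0) (u : Herm n) :
    ((fL μ u Q : ℝ) : ℂ) = (1 / (2 * n)) * ((u : Matrix (Fin n) (Fin n) ℂ) *
      (ketBra z (momentumVec μ Q.p z) + ketBra (momentumVec μ Q.p z) z)).trace := by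
  rw [fL, ofReal_fS hn hQ hz, selfAdjoint.val_one, Matrix.mul_one, Matrix.one_mul, ← trace_add,
    ← mul_add]

/-- Cyclicity brings u to the front of the trace, the shape in which completeness can be summed over
u. -/
theorem ofReal_fLL (hn : n ≠ 0) (hQ : (Q.x : Matrix (Fin n) (Fin n) ℂ) = ketBra z z)
    (hz : star z ⬝ᵥ z ≠ 0) (u v : Herm n) :
    ((fLL μ u v Q : ℝ) : ℂ) = (1 / (4 * n)) * ((u : Matrix (Fin n) (Fin n) ℂ) *
      ((v : Matrix (Fin n) (Fin n) ℂ)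
          * (ketBra z (momentumVec μ Q.p z) - ketBra (momentumVec μ Q.p z) z)
        - (ketBra z (momentumVec μ Q.p z) - ketBra (momentumVec μ Q.p z) z)
          * (v : Matrix (Fin n) (Fin n) ℂ))).trace := by
  have h : ∀ A : Matrix (Fin n) (Fin n) ℂ, ((v : Matrix (Fin n) (Fin n) ℂ) *
      ((u : Matrix (Fin n) (Fin n) ℂ) * A)).trace
      = ((u : Matrix (Fin n) (Fin n) ℂ) * (A * (v : Matrix (Fin n) (Fin n) ℂ))).trace := fun A => by
    rw [trace_mul_comm, Matrix.mul_assoc]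
  rw [fLL]
  push_cast
  rw [ofReal_fS hn hQ hz, ofReal_fS hn hQ hz]
  simp only [Matrix.mul_assoc, h, mul_sub, sub_mul, trace_sub]
  field_simp
  ring

end Vectors

/-! ### The sums over the basis. -/

section Relations

variable {n : ℕ} {ι : Type*} [Fintype ι] {e : Module.Basis ι ℝ (Herm n)}

/-- Serves the double sum of (vii), with D = z w^* - w z^*. Both terms of the expanded square come
from `sum_mul_mul`, applied to D and to the identity. -/
theorem sum_trace_commutator_sq (hn : n ≠ 0) (hunit : ∀ α, ip (e α) (e α) = 1)
    (horth : ∀ α β, α ≠ β → ip (e α) (e β) = 0) (D : Matrix (Fin n) (Fin n) ℂ) :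
    ∑ β, (((e β : Matrix (Fin n) (Fin n) ℂ) * D - D * (e β : Matrix (Fin n) (Fin n) ℂ))
        * ((e β : Matrix (Fin n) (Fin n) ℂ) * D - D * (e β : Matrix (Fin n) (Fin n) ℂ))).trace
      = 2 * n * (D.trace ^ 2 - n * (D * D).trace) := by
  have h1 := congrArg (fun M => (M * D).trace) (sum_mul_mul hunit horth hn D)
  have h2 := congrArg (fun M => (M * (D * D)).trace) (sum_mul_mul hunit horth hn 1)
  simp only [Finset.sum_mul, trace_sum, smul_mul_assoc, trace_smul, smul_eq_mul, Matrix.one_mul,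
    Matrix.mul_one, trace_one, Fintype.card_fin] at h1 h2
  have h : ∀ β, (((e β : Matrix (Fin n) (Fin n) ℂ) * D - D * (e β : Matrix (Fin n) (Fin n) ℂ))
        * ((e β : Matrix (Fin n) (Fin n) ℂ) * D - D * (e β : Matrix (Fin n) (Fin n) ℂ))).trace
      = 2 * ((e β : Matrix (Fin n) (Fin n) ℂ) * D * (e β : Matrix (Fin n) (Fin n) ℂ) * D).trace
        - 2 * ((e β : Matrix (Fin n) (Fin n) ℂ) * (e β : Matrix (Fin n) (Fin n) ℂ)
          * (D * D)).trace := fun β => by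
    generalize (e β : Matrix (Fin n) (Fin n) ℂ) = b
    have e1 : (D * (b * (D * b))).trace = (b * (D * (b * D))).trace := by
      rw [trace_mul_comm]; simp only [Matrix.mul_assoc]
    have e2 : (D * (b * (b * D))).trace = (b * (b * (D * D))).trace := by
      rw [trace_mul_comm]; simp only [Matrix.mul_assoc]
    have e3 : (b * (D * (D * b))).trace = (b * (b * (D * D))).trace := by
      rw [← Matrix.mul_assoc D, ← Matrix.mul_assoc, trace_mul_comm]
    simp only [mul_sub, sub_mul, trace_sub, Matrix.mul_assoc, e1, e2, e3]
    ring
  simp_rw [h, Finset.sum_sub_distrib, ← Finset.mul_sum, h1, h2]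
  ring

theorem sum_smul_trace_mul_smul_trace (hn : n ≠ 0) (hunit : ∀ α, ip (e α) (e α) = 1)
    (horth : ∀ α β, α ≠ β → ip (e α) (e β) = 0) (c d : ℂ) (A B : Matrix (Fin n) (Fin n) ℂ) :
    ∑ α, (c * ((e α : Matrix (Fin n) (Fin n) ℂ) * A).trace)
      * (d * ((e α : Matrix (Fin n) (Fin n) ℂ) * B).trace) = c * d * n * (A * B).trace := by
  rw [mul_assoc (c * d), ← sum_trace_mul_trace hunit horth hn, Finset.mul_sum]
  exact Finset.sum_congr rfl fun α _ => by ring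

end Relations
end U1Kepler

theorem theorem5p1 (n : ℕ) (hn : 2 ≤ n) (μ : ℝ)
    {ι : Type*} [Fintype ι] (e : Module.Basis ι ℝ (U1Kepler.Herm n))
    (he_unit : ∀ α, U1Kepler.ip (e α) (e α) = 1)
    (he_orth : ∀ α β, α ≠ β → U1Kepler.ip (e α) (e β) = 0)
    (u : U1Kepler.Herm n) (Q : U1Kepler.TangentCone n) :
    -- (i)
    ((2 / (n : ℝ)) * ∑ α, U1Kepler.fL μ (e α) Q ^ 2 - U1Kepler.fL μ 1 Q ^ 2
        - U1Kepler.fX μ 1 Q * U1Kepler.fY 1 Q = -μ ^ 2)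
    -- (ii)
    ∧ (∑ α, U1Kepler.fX μ (e α) Q * U1Kepler.fL μ (e α) Q
        = n * (U1Kepler.fX μ 1 Q * U1Kepler.fL μ 1 Q))
    ∧ (∑ α, U1Kepler.fY (e α) Q * U1Kepler.fL μ (e α) Q
        = n * (U1Kepler.fY 1 Q * U1Kepler.fL μ 1 Q))
    -- (iii)
    ∧ ((4 / (n : ℝ)) * ∑ α, U1Kepler.fLL μ (e α) u Q * U1Kepler.fL μ (e α) Q
        = -(U1Kepler.fX μ u Q * U1Kepler.fY 1 Q) + U1Kepler.fX μ 1 Q * U1Kepler.fY u Q)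
    -- (iv)
    ∧ (∑ α, U1Kepler.fX μ (e α) Q ^ 2 = n * U1Kepler.fX μ 1 Q ^ 2)
    ∧ (∑ α, U1Kepler.fY (e α) Q ^ 2 = n * U1Kepler.fY 1 Q ^ 2)
    -- (v)
    ∧ ((2 / (n : ℝ)) * ∑ α, U1Kepler.fLL μ (e α) u Q * U1Kepler.fX μ (e α) Q
        = -(U1Kepler.fX μ u Q * U1Kepler.fL μ 1 Q) + U1Kepler.fL μ u Q * U1Kepler.fX μ 1 Q)
    ∧ ((2 / (n : ℝ)) * ∑ α, U1Kepler.fLL μ (e α) u Q * U1Kepler.fY (e α) Q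
        = U1Kepler.fY u Q * U1Kepler.fL μ 1 Q - U1Kepler.fL μ u Q * U1Kepler.fY 1 Q)
    -- (vi)
    ∧ (∑ α, U1Kepler.fX μ (e α) Q * U1Kepler.fY (e α) Q
        = n * (U1Kepler.fL μ 1 Q ^ 2 + μ ^ 2))
    -- (vii)
    ∧ ((4 / (n : ℝ) ^ 3) * ∑ α, ∑ β, U1Kepler.fLL μ (e α) (e β) Q ^ 2
        = U1Kepler.fX μ 1 Q * U1Kepler.fY 1 Q - U1Kepler.fL μ 1 Q ^ 2
          + (((n : ℝ) - 2) / n) * μ ^ 2) := by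
  have hn0 : n ≠ 0 := by omega
  have hn' : (n : ℂ) ≠ 0 := by exact_mod_cast hn0
  obtain ⟨z, hQ, hz⟩ := U1Kepler.exists_eq_ketBra_self Q.posSemidef Q.rank_eq_one
  have hX := U1Kepler.ofReal_fX (μ := μ) hn0 hQ hz
  have hY := U1Kepler.ofReal_fY hn0 hQ
  have hL := U1Kepler.ofReal_fL (μ := μ) hn0 hQ hz
  have hLL := U1Kepler.ofReal_fLL (μ := μ) hn0 hQ hz
  have hs := U1Kepler.star_dotProduct_momentumVec (μ := μ) hz Q.p
  have hsum := U1Kepler.sum_smul_trace_mul_smul_trace hn0 he_unit he_orth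
  have hcomm := U1Kepler.sum_trace_commutator_sq hn0 he_unit he_orth
  -- The relations hold for any vector b satisfying `hs`, so the formula for w can be forgotten.
  generalize U1Kepler.momentumVec μ Q.p z = b at hX hY hL hLL hs
  have hu : ∀ (c d : Fin n → ℂ) (A : Matrix (Fin n) (Fin n) ℂ),
      (U1Kepler.ketBra c d * ((u : Matrix (Fin n) (Fin n) ℂ) * A)).trace
        = ((u : Matrix (Fin n) (Fin n) ℂ) * (A * U1Kepler.ketBra c d)).trace := fun c d A => by
    rw [Matrix.trace_mul_comm, Matrix.mul_assoc]
  replace hs : dotProduct (star z) b = dotProduct (star b) z + 2 * Complex.I * n * μ := by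
    rw [← hs]; ring
  refine ⟨?_, ?_, ?_, ?_, ?_, ?_, ?_, ?_, ?_, ?_⟩
  -- The index in the first slot of `fLL` must be summed innermost for `hsum` to apply.
  on_goal 10 => rw [Finset.sum_comm]
  all_goals
    apply Complex.ofReal_injective
    push_cast
    simp only [sq, hX, hY, hL, hLL, hsum, selfAdjoint.val_one, Matrix.one_mul]
  on_goal 10 => rw [← Finset.mul_sum, hcomm]
  all_goals
    simp only [mul_add, mul_sub, add_mul, sub_mul, Matrix.mul_assoc, hu,
      U1Kepler.ketBra_mul_ketBra, Matrix.mul_smul, Matrix.trace_add, Matrix.trace_sub,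
      Matrix.trace_smul, U1Kepler.trace_ketBra, smul_eq_mul, hs]
    field_simp
    try ring_nf
    try (simp only [Complex.I_sq]; ring)
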